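/- A *level* (essential subtopos) of a topos $\mathcal A$ is a category $\mathcal B$ with functors $i_!\dashv i^*\dashv i_*$, where $i^*:\mathcal A\to\mathcal B$ and $i_*$ is fully faithful. An object $A$ is $\mathcal B$-skeletal if $A\cong i_!i^*A$ and $\mathcal B$-coskeletal if $A\cong i_*i^*A$. A level $\mathcal B'$ is lower than $\mathcal B$ if every $\mathcal B'$-skeletal object is $\mathcal B$-skeletal and every $\mathcal B'$-coskeletal object is $\mathcal B$-coskeletal; it is way below $\mathcal B$ if, in addition, every $\mathcal B'$-skeletal object is $\mathcal B$-coskeletal. The Aufhebung of $\mathcal B'$ is the smallest level that $\mathcal B'$ is way below. The level $n$ of the topos of simplicial sets is the category of presheaves on the full subcategory $\Delta_n\subset\Delta$ on $[0],\dots,[n]$, with restriction and left and right Kan extension; its skeletal and coskeletal objects are called $n$-skeletal and $n$-coskeletal. Write $d_i$ and $s_i$ for the face and degeneracy operators of a simplicial set. A $k$-sphere in a simplicial set is a sequence $c_0,\dots,c_k$ of $(k-1)$-simplices with $d_ic_j=d_{j-1}c_i$ for $i<j$; a filler of it is a $k$-simplex $y$ with $d_iy=c_i$ for all $i$. **Theorem.**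 For every $n\ge 2$, the Aufhebung of the level $n$ of the topos of simplicial sets is the level $2n-1$. More explicitly: 1. If $n\ge 2$, every $n$-skeletal simplicial set is $(2n-1)$-coskeletal, and in it every $k$-sphere with $k>2n-1$ has a unique filler. 2. If $n\ge 3$, there is an $n$-skeletal simplicial set $X$ generated by a vertex $v$, distinct nondegenerate $(n-1)$-simplices $x',y'$ all of whose faces are degenerate at $v$, and distinct nondegenerate $n$-simplices $x,y$ with $d_0x=x'$, $d_ny=y'$ and all other faces degenerate at $v$. In $X$ the $(2n-2)$-simplices $c_0=\dots=c_{n-1}=s_{n-3}\cdots s_0\,x$ and $c_n=\dots=c_{2n-1}=s_{2n-3}\cdots s_n\,y$ form a $(2n-1)$-sphere that has no filler, and $X$ is not $(2n-2)$-coskeletal. Hence $2n-1$ in (1) cannot be replaced by $2n-2$. -/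

import Mathlib

open CategoryTheory Simplicial Opposite

universe v u

/-- A *level* (essential subtopos) of a category `A` (in the intended use, a topos): a category
`carrier` with a functor `restr = i^*` from `A` which has a left adjoint `skel = i_!` and a fully
faithful right adjoint `coskel = i_*`. Being a right adjoint, `i^*` preserves finite limits, so
that `i_*` is a geometric inclusion (and `carrier` is a topos when `A` is one).
Since `carrier` is equivalent to a full subcategory of `A`, taking it in the universes of `A`
is no restriction. -/
structure EssentialSubtopos (A : Type u) [Category.{v} A] where
  carrier : Type u
  [cat : Category.{v} carrier]
  /-- the restriction `i^*` -/
  restr : A ⥤ carrier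
  /-- the skeletal inclusion `i_!` -/
  skel : carrier ⥤ A
  /-- the coskeletal inclusion `i_*` -/
  coskel : carrier ⥤ A
  /-- `i_! ⊣ i^*` -/
  skelAdj : skel ⊣ restr
  /-- `i^* ⊣ i_*` -/
  coskelAdj : restr ⊣ coskel
  full : coskel.Full
  faithful : coskel.Faithful

namespace EssentialSubtopos

attribute [instance] EssentialSubtopos.cat

variable {A : Type u} [Category.{v} A]

/-- `X` is `L`-skeletal if it is isomorphic to `sk_L X = i_! i^* X`. -/
def IsSkeletal (L : EssentialSubtopos.{v, u} A) (X : A) : Prop :=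
  Nonempty (X ≅ L.skel.obj (L.restr.obj X))

/-- `X` is `L`-coskeletal if it is isomorphic to `cosk_L X = i_* i^* X`. -/
def IsCoskeletal (L : EssentialSubtopos.{v, u} A) (X : A) : Prop :=
  Nonempty (X ≅ L.coskel.obj (L.restr.obj X))

/-- `L` is lower than `M`: the skeletal and the coskeletal inclusion of `L` factor through those
of `M`, that is, `L`-skeletal objects are `M`-skeletal and `L`-coskeletal ones `M`-coskeletal. -/
def IsLowerThan (L M : EssentialSubtopos.{v, u} A) : Prop :=
  (∀ X : A, L.IsSkeletal X → M.IsSkeletal X) ∧ (∀ X : A, L.IsCoskeletal X → M.IsCoskeletal X)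

/-- `L` is way below `M`: it is lower than `M` and `L`-skeletal implies `M`-coskeletal. -/
def IsWayBelow (L M : EssentialSubtopos.{v, u} A) : Prop :=
  L.IsLowerThan M ∧ ∀ X : A, L.IsSkeletal X → M.IsCoskeletal X

/-- `M` is the Aufhebung of `L`: the smallest level that `L` is way below. -/
def IsAufhebung (L M : EssentialSubtopos.{v, u} A) : Prop :=
  L.IsWayBelow M ∧ ∀ N : EssentialSubtopos.{v, u} A, L.IsWayBelow N → M.IsLowerThan N

end EssentialSubtopos

namespace SSet

/-- The level `n` of simplicial sets: presheaves on the full subcategory of the simplex category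
on `⦋0⦌, …, ⦋n⦌`, with restriction and the left and right Kan extensions. -/
noncomputable def level (n : ℕ) : EssentialSubtopos.{u, u + 1} SSet.{u} where
  carrier := SSet.Truncated.{u} n
  restr := SimplicialObject.truncation n
  skel := SimplicialObject.Truncated.sk n
  coskel := SimplicialObject.Truncated.cosk n
  skelAdj := SimplicialObject.skAdj n
  coskelAdj := SimplicialObject.coskAdj n
  full := inferInstance
  faithful := inferInstance

variable {X : SSet.{u}}

/-- A sequence `c_0, …, c_k` of `(k-1)`-simplices of `X` is a `k`-sphere if
`d_i c_j = d_{j-1} c_i` for all `i < j ≤ k`. Here `k = m + 2`, and `j` is written as a successor.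
(For `k = 1` there would be no equation.) -/
def IsSphere {m : ℕ} (c : Fin (m + 3) → X _⦋m + 1⦌) : Prop :=
  ∀ i j : Fin (m + 2), i ≤ j → X.δ i (c j.succ) = X.δ j (c i.castSucc)

/-- The `k`-simplex `y` fills the `k`-sphere `c` if its faces are the `c_i` (with `k = m + 2`). -/
def Fills {m : ℕ} (y : X _⦋m + 2⦌) (c : Fin (m + 3) → X _⦋m + 1⦌) : Prop :=
  ∀ i : Fin (m + 3), X.δ i y = c i

/-- The `m`-simplex that is degenerate at the vertex `v`. -/
def degenerateAt (v : X _⦋0⦌) (m : ℕ) : X _⦋m⦌ :=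
  X.map (SimplexCategory.const ⦋m⦌ ⦋0⦌ 0).op v

/-- The epimorphism `σ^0 σ^1 ⋯ σ^{n-3} : ⦋2n-2⦌ ⟶ ⦋n⦌` with `n = p + 2`, which maps the first
`n - 1` elements to `0`. -/
def collapseFirst (p : ℕ) : ⦋2 * p + 2⦌ ⟶ ⦋p + 2⦌ :=
  SimplexCategory.Hom.mk
    { toFun := fun j => ⟨(j : ℕ) - p, by have := j.isLt; simp at this ⊢; omega⟩
      monotone' := fun i j h => by
        have h' : (i : ℕ) ≤ (j : ℕ) := h
        exact Fin.mk_le_mk.2 (by omega) }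

/-- The epimorphism `σ^n σ^{n+1} ⋯ σ^{2n-3} : ⦋2n-2⦌ ⟶ ⦋n⦌` with `n = p + 2`, which maps the last
`n - 1` elements to `n`. -/
def collapseLast (p : ℕ) : ⦋2 * p + 2⦌ ⟶ ⦋p + 2⦌ :=
  SimplexCategory.Hom.mk
    { toFun := fun j => ⟨min (j : ℕ) (p + 2), by simp⟩
      monotone' := fun i j h => by
        have h' : (i : ℕ) ≤ (j : ℕ) := h
        exact Fin.mk_le_mk.2 (by omega) }

/-- With `n = p + 2`: the simplicial set `X` is generated by a vertex `v`, distinct nondegenerate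
`(n-1)`-simplices `x'`, `y'` whose faces are degenerate at `v`, and distinct nondegenerate
`n`-simplices `x`, `y` with `d_0 x = x'` and `d_n y = y'` whose other faces are degenerate
at `v`. -/
structure IsGeneratedByPair {p : ℕ} (v : X _⦋0⦌) (x' y' : X _⦋p + 1⦌) (x y : X _⦋p + 2⦌) :
    Prop where
  generated : Subcomplex.ofSimplex v ⊔ Subcomplex.ofSimplex x' ⊔ Subcomplex.ofSimplex y' ⊔
    Subcomplex.ofSimplex x ⊔ Subcomplex.ofSimplex y = ⊤
  nonDegenerate_x' : x' ∈ X.nonDegenerate (p + 1)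
  nonDegenerate_y' : y' ∈ X.nonDegenerate (p + 1)
  nonDegenerate_x : x ∈ X.nonDegenerate (p + 2)
  nonDegenerate_y : y ∈ X.nonDegenerate (p + 2)
  x'_ne_y' : x' ≠ y'
  x_ne_y : x ≠ y
  face_x' : ∀ i : Fin (p + 2), X.δ i x' = degenerateAt v p
  face_y' : ∀ i : Fin (p + 2), X.δ i y' = degenerateAt v p
  face_zero_x : X.δ 0 x = x'
  face_last_y : X.δ (Fin.last (p + 2)) y = y'
  face_x : ∀ i : Fin (p + 3), i ≠ 0 → X.δ i x = degenerateAt v (p + 1)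
  face_y : ∀ i : Fin (p + 3), i ≠ Fin.last (p + 2) → X.δ i y = degenerateAt v (p + 1)

/-- With `n = p + 2`: the sequence `c_0 = ⋯ = c_{n-1} = x σ^0 ⋯ σ^{n-3}` and
`c_n = ⋯ = c_{2n-1} = y σ^n ⋯ σ^{2n-3}` of `(2n-2)`-simplices. -/
def pairSphere {p : ℕ} (x y : X _⦋p + 2⦌) (i : Fin (2 * p + 4)) : X _⦋2 * p + 2⦌ :=
  if (i : ℕ) < p + 2 then X.map (collapseFirst p).op x else X.map (collapseLast p).op y

end SSet

/-!
Maps `f` inverted by the restriction of a level `L` are tested against objects: `L`-skeletal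
objects are left orthogonal and `L`-coskeletal objects right orthogonal to them, and these
orthogonality properties characterize both classes of objects. So a level becomes higher when it
inverts fewer maps (`isLowerThan_of_isIso_restr_map`). The level `n` inverts the maps that are
bijective in dimensions at most `n`. Its skeletal objects are the simplicial sets of dimension at
most `n`, and spheres are maps from boundaries of standard simplices, so that a simplicial set is
`n`-coskeletal as soon as its spheres of dimension greater than `n` have unique fillers.

*Fillers.* Let `X` have dimension at most `n ≥ 2`, and let `c` be a `k`-sphere in `X` with
`k ≥ 2 n`. Each `c t` is a `(k-1)`-simplex with vertices `{0, …, k} \ {t}` and has a rank, the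
dimension of its underlying nondegenerate simplex, which is at most `n`. If the degeneracy of `c t`
joins a vertex `s` to a neighbour, then the face of `c t` opposite to `s`, which is also a face of
`c s`, has the same rank as `c t`; hence `c s` has maximal rank if `c t` does. Let `j` be the least
index for which `c j` has maximal rank. Then no vertex below `j` is joined to another one in `c j`,
or in `c s` for any `s` of maximal rank above `j`. It follows that `y = σ j (c j)` has the face
`c s` for `s = j` and for each vertex `s` that is joined to a neighbour in `c j`. These are at
least `k - n + 1 ≥ n + 1` indices, and two degenerate simplices that agree on so many faces are
equal (`eq_of_mem_range_σ`), which gives the remaining faces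
(`IsSphere.exists_fills_of_hasDimensionLE`). Uniqueness is the classical fact that degenerate
simplices are determined by their faces.

*Optimality.* For every level `N` and every `m`, either `Δ[m]` is `N`-skeletal, and then `N` is
above the level `m`, or `N` inverts `∂Δ[m] ⟶ Δ[m]`, and then `m`-spheres in `N`-coskeletal objects
have fillers (`isSkeletal_stdSimplex_or_isIso`). For `m = 2 n - 1` the second case is impossible
when the level `n` is way below `N`, since the wedge of `Δ[n] / Λ[n, 0]` and `Δ[n] / Λ[n, n]` is
`n`-skeletal and contains an `m`-sphere without filler: the first and the last simplex of the sphere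
are not degenerate at the base point, and lie in
different summands, whereas all faces of a simplex lie in one summand.
-/

/-! ### Orthogonality for levels -/

namespace EssentialSubtopos

variable {A : Type u} [Category.{v} A] (L : EssentialSubtopos.{v, u} A)

instance isIso_coskelAdj_counit : IsIso L.coskelAdj.counit :=
  have := L.full
  have := L.faithful
  inferInstance

instance isIso_skelAdj_unit : IsIso L.skelAdj.unit :=
  (Adjunction.Triple.isIso_unit_iff_isIso_counit
    ⟨L.skelAdj, L.coskelAdj⟩).2 L.isIso_coskelAdj_counit

instance isIso_restr_map_skelAdj_counit (X : A) :
    IsIso (L.restr.map (L.skelAdj.counit.app X)) := by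
  have h := L.skelAdj.right_triangle_components X
  rw [← IsIso.eq_inv_comp] at h
  rw [h]
  infer_instance

instance isIso_restr_map_coskelAdj_unit (X : A) :
    IsIso (L.restr.map (L.coskelAdj.unit.app X)) := by
  have h := L.coskelAdj.left_triangle_components X
  rw [← IsIso.eq_comp_inv] at h
  rw [h, Category.id_comp]
  infer_instance

variable {L}

lemma isSkeletal_skel_obj (B : L.carrier) : L.IsSkeletal (L.skel.obj B) :=
  ⟨L.skel.mapIso (asIso (L.skelAdj.unit.app B))⟩

lemma isCoskeletal_coskel_obj (B : L.carrier) : L.IsCoskeletal (L.coskel.obj B) :=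
  ⟨L.coskel.mapIso (asIso (L.coskelAdj.counit.app B)).symm⟩

/-- Skeletal objects are left orthogonal to the maps that the level inverts. -/
lemma IsSkeletal.bijective_comp {X : A} (hX : L.IsSkeletal X) {Y Z : A} (f : Y ⟶ Z)
    [IsIso (L.restr.map f)] : Function.Bijective (fun g : X ⟶ Y => g ≫ f) := by
  obtain ⟨e⟩ := hX
  let φ (W : A) : (X ⟶ W) ≃ (L.restr.obj X ⟶ L.restr.obj W) :=
    (e.homCongr (Iso.refl W)).trans (L.skelAdj.homEquiv _ _)
  have h : φ Z ∘ (fun g : X ⟶ Y => g ≫ f) = (fun g => g ≫ L.restr.map f) ∘ φ Y := by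
    funext g
    simp [φ, Adjunction.homEquiv_unit]
  rw [← (φ Z).bijective.of_comp_iff', h]
  exact (asIso (L.restr.map f)).homToEquiv.bijective.comp (φ Y).bijective

/-- Coskeletal objects are right orthogonal to the maps that the level inverts. -/
lemma IsCoskeletal.bijective_comp {X : A} (hX : L.IsCoskeletal X) {Y Z : A} (f : Y ⟶ Z)
    [IsIso (L.restr.map f)] : Function.Bijective (fun g : Z ⟶ X => f ≫ g) := by
  obtain ⟨e⟩ := hX
  let φ (W : A) : (W ⟶ X) ≃ (L.restr.obj W ⟶ L.restr.obj X) :=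
    ((Iso.refl W).homCongr e).trans (L.coskelAdj.homEquiv _ _).symm
  have h : φ Y ∘ (fun g : Z ⟶ X => f ≫ g) = (fun g => L.restr.map f ≫ g) ∘ φ Z := by
    funext g
    simp [φ, Adjunction.homEquiv_counit]
  rw [← (φ Y).bijective.of_comp_iff', h]
  exact (asIso (L.restr.map f)).homFromEquiv.symm.bijective.comp (φ Z).bijective

/-- A section of the counit is an inverse of it. -/
lemma isSkeletal_of_section {X : A} (s : X ⟶ L.skel.obj (L.restr.obj X))
    (hs : s ≫ L.skelAdj.counit.app X = 𝟙 X) : L.IsSkeletal X := by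
  refine ⟨⟨s, L.skelAdj.counit.app X, hs, ?_⟩⟩
  refine ((isSkeletal_skel_obj (L.restr.obj X)).bijective_comp
    (L.skelAdj.counit.app X)).injective ?_
  simp [hs]

/-- A retraction of the unit is an inverse of it. -/
lemma isCoskeletal_of_retraction {X : A} (r : L.coskel.obj (L.restr.obj X) ⟶ X)
    (hr : L.coskelAdj.unit.app X ≫ r = 𝟙 X) : L.IsCoskeletal X := by
  refine ⟨⟨L.coskelAdj.unit.app X, r, hr, ?_⟩⟩
  refine ((isCoskeletal_coskel_obj (L.restr.obj X)).bijective_comp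
    (L.coskelAdj.unit.app X)).injective ?_
  simp [reassoc_of% hr]

/-- A retract of a skeletal object is skeletal. -/
lemma IsSkeletal.of_retract {X Y : A} (hY : L.IsSkeletal Y) (i : X ⟶ Y) (r : Y ⟶ X)
    (h : i ≫ r = 𝟙 X) : L.IsSkeletal X := by
  obtain ⟨s, hs⟩ := (hY.bijective_comp (L.skelAdj.counit.app X)).surjective r
  exact isSkeletal_of_section (i ≫ s) (by simpa [h] using congrArg (i ≫ ·) hs)

lemma isLowerThan_of_isIso_restr_map {L M : EssentialSubtopos.{v, u} A}
    (h : ∀ {Y Z : A} (f : Y ⟶ Z), IsIso (M.restr.map f) → IsIso (L.restr.map f)) :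
    L.IsLowerThan M := by
  constructor
  · intro X hX
    have := h (M.skelAdj.counit.app X) inferInstance
    obtain ⟨s, hs⟩ := (hX.bijective_comp (M.skelAdj.counit.app X)).surjective (𝟙 X)
    exact isSkeletal_of_section s hs
  · intro X hX
    have := h (M.coskelAdj.unit.app X) inferInstance
    obtain ⟨r, hr⟩ := (hX.bijective_comp (M.coskelAdj.unit.app X)).surjective (𝟙 X)
    exact isCoskeletal_of_retraction r hr

end EssentialSubtopos

/-! ### The levels of simplicial sets -/

namespace SSet

lemma isIso_level_restr_map_iff (n : ℕ) {X Y : SSet.{u}} (f : X ⟶ Y) :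
    IsIso ((level.{u} n).restr.map f) ↔
      ∀ m ≤ n, Function.Bijective (f.app (op ⦋m⦌)) := by
  change IsIso ((SimplicialObject.truncation n).map f) ↔ _
  rw [NatTrans.isIso_iff_isIso_app]
  constructor
  · intro h m hm
    exact (isIso_iff_bijective _).1 (h (op ⟨⦋m⦌, hm⟩))
  · rintro h ⟨⟨m, hm⟩⟩
    exact (isIso_iff_bijective (f.app (op ⦋m.len⦌))).2 (h m.len hm)

lemma level_isLowerThan_level {n m : ℕ} (h : n ≤ m) :
    (level.{u} n).IsLowerThan (level.{u} m) :=
  EssentialSubtopos.isLowerThan_of_isIso_restr_map fun f hf =>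
    (isIso_level_restr_map_iff n f).2 fun k hk =>
      (isIso_level_restr_map_iff m f).1 hf k (hk.trans h)

/-- An `n`-skeletal simplicial set has dimension at most `n`: it is left orthogonal to the
inclusion of the subcomplex generated by its simplices of dimension at most `n`, which therefore
has a section. -/
lemma hasDimensionLE_of_isSkeletal {n : ℕ} {X : SSet.{u}} (hX : (level.{u} n).IsSkeletal X) :
    X.HasDimensionLE n where
  degenerate_eq_top m hm := by
    have : IsIso ((level.{u} n).restr.map (X.skeleton (n + 1)).ι) := by
      rw [isIso_level_restr_map_iff]
      intro k hk
      refine ⟨fun a b h => Subtype.ext h, fun x => ⟨⟨x, X.mem_skeleton x (by lia)⟩, rfl⟩⟩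
    obtain ⟨s, hs⟩ := (hX.bijective_comp (X.skeleton (n + 1)).ι).surjective (𝟙 X)
    rw [Set.top_eq_univ, Set.eq_univ_iff_forall]
    intro x
    by_contra hx
    have h1 : x ∈ (X.skeleton (n + 1)).obj (op ⦋m⦌) := by
      have := ConcreteCategory.congr_hom (NatTrans.congr_app hs (op ⦋m⦌)) x
      have h2 : ((s.app (op ⦋m⦌) x).1 : X _⦋m⦌) = x := this
      rw [← h2]
      exact (s.app (op ⦋m⦌) x).2
    have := (X.mem_skeleton_obj_iff_of_nonDegenerate ⟨x, hx⟩ (n + 1)).1 h1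
    lia

/-- A map between simplicial sets of dimension at most `n` is an isomorphism as soon as it is
bijective on simplices of dimension at most `n`: by the Eilenberg-Zilber lemma, every simplex is
an iterated degeneracy of a unique simplex among those. -/
lemma isIso_of_hasDimensionLE {n : ℕ} {X Y : SSet.{u}} (f : X ⟶ Y) [X.HasDimensionLE n]
    [Y.HasDimensionLE n] (h : ∀ m ≤ n, Function.Bijective (f.app (op ⦋m⦌))) : IsIso f := by
  have hnd : ∀ m (x : X.nonDegenerate m), f.app (op ⦋m⦌) x.1 ∈ Y.nonDegenerate m := by
    intro m x hx
    have hm := X.dim_le_of_nonDegenerate x n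
    obtain ⟨k, hk, g, y, hy⟩ := hx
    obtain ⟨z, rfl⟩ := (h k (by lia)).surjective y
    refine x.2 ⟨k, hk, g, z, (h m hm).injective ?_⟩
    rw [← hy]
    exact NatTrans.naturality_apply f g.op z
  rw [NatTrans.isIso_iff_isIso_app]
  rintro ⟨⟨k⟩⟩
  refine (isIso_iff_bijective _).2 ⟨fun a b hab => ?_, fun y => ?_⟩
  · obtain ⟨m₁, g₁, _, x₁, rfl⟩ := X.exists_nonDegenerate (n := k) a
    obtain ⟨m₂, g₂, _, x₂, rfl⟩ := X.exists_nonDegenerate (n := k) b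
    have h1 : f.app (op ⦋k⦌) (X.map g₁.op x₁.1) = Y.map g₁.op (f.app _ x₁.1) :=
      NatTrans.naturality_apply f g₁.op x₁.1
    have h2 : f.app (op ⦋k⦌) (X.map g₁.op x₁.1) = Y.map g₂.op (f.app _ x₂.1) :=
      Eq.trans hab (NatTrans.naturality_apply f g₂.op x₂.1)
    obtain rfl := Y.unique_nonDegenerate_dim _ g₁ ⟨_, hnd _ x₁⟩ h1 g₂ ⟨_, hnd _ x₂⟩ h2
    obtain rfl := Y.unique_nonDegenerate_map _ g₁ ⟨_, hnd _ x₁⟩ h1 g₂ ⟨_, hnd _ x₂⟩ h2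
    have h3 := Y.unique_nonDegenerate_simplex _ g₁ ⟨_, hnd _ x₁⟩ h1 g₁ ⟨_, hnd _ x₂⟩ h2
    have h4 := (h m₁ (X.dim_le_of_nonDegenerate x₁ n)).injective (congrArg Subtype.val h3)
    rw [h4]
  · obtain ⟨m, g, _, y, rfl⟩ := Y.exists_nonDegenerate (n := k) y
    obtain ⟨x, hx⟩ := (h m (Y.dim_le_of_nonDegenerate y n)).surjective y.1
    exact ⟨X.map g.op x, by rw [← hx]; exact NatTrans.naturality_apply f g.op x⟩

lemma isSkeletal_of_hasDimensionLE {n : ℕ} {X : SSet.{u}} [X.HasDimensionLE n] :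
    (level.{u} n).IsSkeletal X := by
  let ε : (level.{u} n).skel.obj ((level.{u} n).restr.obj X) ⟶ X :=
    (level.{u} n).skelAdj.counit.app X
  have : SSet.HasDimensionLE ((level.{u} n).skel.obj ((level.{u} n).restr.obj X)) n :=
    hasDimensionLE_of_isSkeletal (EssentialSubtopos.isSkeletal_skel_obj _)
  have := isIso_of_hasDimensionLE ε ((isIso_level_restr_map_iff n ε).1 inferInstance)
  exact ⟨(asIso ε).symm⟩

end SSet

/-! ### Spheres, boundaries and coskeletal simplicial sets -/

namespace SSet

variable {X : SSet.{u}}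

/-- The simplices of a sphere `c` define one value on a simplex that lies on two faces of the
boundary of the standard simplex. -/
lemma IsSphere.map_eq_of_lt {m : ℕ} {c : Fin (m + 3) → X _⦋m + 1⦌} (hc : IsSphere c)
    {d : SimplexCategory} {i j : Fin (m + 3)} (hij : i < j) (f g : d ⟶ ⦋m + 1⦌)
    (h : f ≫ SimplexCategory.δ i = g ≫ SimplexCategory.δ j) :
    X.map f.op (c i) = X.map g.op (c j) := by
  obtain ⟨a, rfl⟩ := Fin.exists_castSucc_eq.2 (Fin.ne_last_of_lt hij)
  obtain ⟨b, rfl⟩ := Fin.exists_succ_eq.2 (Fin.ne_zero_of_lt hij)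
  have hab : a ≤ b := by
    simp only [Fin.lt_def, Fin.le_def, Fin.val_castSucc, Fin.val_succ] at hij ⊢
    lia
  have key : ∀ x, a.castSucc.succAbove (f.toOrderHom x) = b.succ.succAbove (g.toOrderHom x) :=
    fun x => SimplexCategory.congr_toOrderHom_apply h x
  obtain ⟨f', rfl⟩ := SimplexCategory.eq_comp_δ_of_not_surjective' f b (fun x hx => by
    have := key x
    rw [hx, Fin.succAbove_of_le_castSucc _ _ (Fin.le_def.2 (Fin.le_def.1 hab))] at this
    exact Fin.succAbove_ne _ _ this.symm)
  obtain ⟨g', rfl⟩ := SimplexCategory.eq_comp_δ_of_not_surjective' g a (fun x hx => by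
    have := key x
    rw [hx, Fin.succAbove_of_castSucc_lt b.succ a
      (Fin.lt_def.2 (Nat.lt_succ_of_le (Fin.le_def.1 hab)))] at this
    exact Fin.succAbove_ne _ _ this)
  have h' : f' = g' := by
    rw [← cancel_mono (SimplexCategory.δ b ≫ SimplexCategory.δ a.castSucc)]
    conv_rhs => rw [← SimplexCategory.δ_comp_δ hab]
    simpa using h
  subst h'
  have := congrArg (X.map f'.op) (hc a b hab)
  simp only [SimplicialObject.δ, ← comp_apply, ← Functor.map_comp, ← op_comp] at this
  exact this.symm

lemma IsSphere.map_eq {m : ℕ} {c : Fin (m + 3) → X _⦋m + 1⦌} (hc : IsSphere c)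
    {d : SimplexCategory} {i j : Fin (m + 3)} (f g : d ⟶ ⦋m + 1⦌)
    (h : f ≫ SimplexCategory.δ i = g ≫ SimplexCategory.δ j) :
    X.map f.op (c i) = X.map g.op (c j) := by
  rcases lt_trichotomy i j with hij | rfl | hij
  · exact hc.map_eq_of_lt hij f g h
  · rw [cancel_mono] at h
    rw [h]
  · exact (hc.map_eq_of_lt hij g f h.symm).symm

/-- A sphere defines a map from the boundary of a standard simplex. -/
lemma IsSphere.exists_desc {m : ℕ} {c : Fin (m + 3) → X _⦋m + 1⦌} (hc : IsSphere c) :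
    ∃ g : (∂Δ[m + 2] : SSet.{u}) ⟶ X, ∀ i, boundary.ι i ≫ g = yonedaEquiv.symm (c i) := by
  have h (d : SimplexCategoryᵒᵖ) (x : (∂Δ[m + 2] : SSet.{u}).obj d) :
      ∃ (v : X.obj d) (i : Fin (m + 3)) (f : d.unop ⟶ ⦋m + 1⦌),
        stdSimplex.objEquiv x.1 = f ≫ SimplexCategory.δ i ∧ v = X.map f.op (c i) := by
    obtain ⟨i, f, hf⟩ := SimplexCategory.eq_comp_δ_of_not_surjective
      (stdSimplex.objEquiv x.1) x.2
    exact ⟨_, i, f, hf, rfl⟩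
  choose v i f hf hv using h
  refine ⟨{ app := fun d => ↾(v d), naturality := fun d e φ => ?_ }, fun j => ?_⟩
  · ext x
    change v e _ = X.map φ (v d x)
    rw [hv, hv, ← comp_apply, ← Functor.map_comp]
    refine hc.map_eq _ (φ.unop ≫ f d x) ?_
    rw [← hf, Category.assoc, ← hf]
    rfl
  · apply yonedaEquiv.injective
    rw [Equiv.apply_symm_apply]
    change v _ _ = _
    rw [hv, hc.map_eq (j := j) _ (𝟙 _)]
    · simp
    · rw [← hf]
      rfl

/-- If a level inverts a boundary inclusion, then spheres of that dimension in coskeletal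
simplicial sets have fillers. -/
lemma IsSphere.exists_fills {L : EssentialSubtopos.{u, u + 1} SSet.{u}} (hX : L.IsCoskeletal X)
    {m : ℕ} [IsIso (L.restr.map (boundary.{u} (m + 2)).ι)]
    {c : Fin (m + 3) → X _⦋m + 1⦌} (hc : IsSphere c) : ∃ y, Fills y c := by
  obtain ⟨g, hg⟩ := hc.exists_desc
  obtain ⟨h, hh⟩ := (hX.bijective_comp (boundary.{u} (m + 2)).ι).surjective g
  refine ⟨yonedaEquiv h, fun i => ?_⟩
  apply yonedaEquiv.symm.injective
  rw [← hg i, ← hh, boundary.ι_ι_assoc]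
  apply yonedaEquiv.injective
  rw [Equiv.apply_symm_apply]
  obtain ⟨y, rfl⟩ := yonedaEquiv.symm.surjective h
  rw [Equiv.apply_symm_apply]
  rfl

/-- If a level inverts a boundary inclusion, then simplices of that dimension in coskeletal
simplicial sets are determined by their faces. -/
lemma eq_of_δ_eq {L : EssentialSubtopos.{u, u + 1} SSet.{u}} (hX : L.IsCoskeletal X)
    {m : ℕ} [IsIso (L.restr.map (boundary.{u} (m + 1)).ι)]
    {y z : X _⦋m + 1⦌} (h : ∀ i, X.δ i y = X.δ i z) : y = z := by
  apply yonedaEquiv.symm.injective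
  apply (hX.bijective_comp (boundary.{u} (m + 1)).ι).injective
  apply boundary.hom_ext
  intro i
  change boundary.ι i ≫ (boundary (m + 1)).ι ≫ _ = boundary.ι i ≫ (boundary (m + 1)).ι ≫ _
  rw [boundary.ι_ι_assoc, boundary.ι_ι_assoc]
  apply yonedaEquiv.injective
  exact h i

lemma isIso_level_restr_map_boundary_ι {n k : ℕ} (h : n < k) :
    IsIso ((level.{u} n).restr.map (boundary.{u} k).ι) := by
  rw [isIso_level_restr_map_iff]
  intro m hm
  refine ⟨fun a b h => Subtype.ext h, fun x => ⟨⟨x, ?_⟩, rfl⟩⟩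
  rw [boundary_obj_eq_univ m k (by lia)]
  trivial

lemma isSphere_δ {m : ℕ} (y : X _⦋m + 2⦌) : IsSphere (fun i => X.δ i y) :=
  fun _ _ h => δ_comp_δ_apply h y

/-- A simplicial set in which all spheres of dimension greater than `n` have unique fillers is
`n`-coskeletal: by induction on the dimension, its unit map to the coskeleton is bijective. -/
lemma isCoskeletal_of_existsUnique_fills {n : ℕ} (hn : 1 ≤ n)
    (h : ∀ m : ℕ, n < m + 2 → ∀ c : Fin (m + 3) → X _⦋m + 1⦌, IsSphere c → ∃! y, Fills y c) :
    (level.{u} n).IsCoskeletal X := by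
  let L := level.{u} n
  let Y := L.coskel.obj (L.restr.obj X)
  let η : X ⟶ Y := L.coskelAdj.unit.app X
  have hY : L.IsCoskeletal Y := EssentialSubtopos.isCoskeletal_coskel_obj _
  have hη : ∀ k, ∀ m ≤ k, Function.Bijective (η.app (op ⦋m⦌)) := by
    intro k
    induction k with
    | zero =>
      intro m hm
      exact (isIso_level_restr_map_iff n η).1 (L.isIso_restr_map_coskelAdj_unit X) m (by lia)
    | succ k ih =>
      intro m hm
      by_cases hmn : m ≤ n
      · exact (isIso_level_restr_map_iff n η).1 (L.isIso_restr_map_coskelAdj_unit X) m hmn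
      obtain ⟨m, rfl⟩ : ∃ p, m = p + 2 := ⟨m - 2, by lia⟩
      have h1 := ih (m + 1) (by lia)
      have h0 := ih m (by lia)
      constructor
      · intro a b hab
        obtain ⟨y, -, hy⟩ := h m (by lia) _ (isSphere_δ a)
        rw [hy a fun _ => rfl, hy b fun i => h1.injective ?_]
        exact (δ_naturality_apply η i b).trans
          ((congrArg (Y.δ i) hab.symm).trans (δ_naturality_apply η i a).symm)
      · intro y
        choose c hc using fun i => h1.surjective (Y.δ i y)
        have hs : IsSphere c := fun i j hij => h0.injective (by
          refine (δ_naturality_apply η i _).trans (Eq.trans ?_ (δ_naturality_apply η j _).symm)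
          rw [hc, hc]
          exact δ_comp_δ_apply hij y)
        obtain ⟨x, hx, -⟩ := h m (by lia) c hs
        have := isIso_level_restr_map_boundary_ι.{u} (n := n) (k := m + 2) (by lia)
        refine ⟨x, eq_of_δ_eq (L := L) hY fun i => ?_⟩
        exact (δ_naturality_apply η i x).symm.trans ((congrArg _ (hx i)).trans (hc i))
  have : IsIso η := by
    rw [NatTrans.isIso_iff_isIso_app]
    rintro ⟨⟨k⟩⟩
    exact (isIso_iff_bijective _).2 (hη k k le_rfl)
  exact ⟨asIso η⟩

/-- For every level of simplicial sets and every `m`, either the standard `m`-simplex is skeletal,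
or its boundary inclusion is inverted. Indeed, the counit `ε` at the `m`-simplex either hits the
generator, and then the `m`-simplex is a retract of a skeletal object, or it factors through the
boundary. -/
lemma isSkeletal_stdSimplex_or_isIso (L : EssentialSubtopos.{u, u + 1} SSet.{u}) (m : ℕ) :
    L.IsSkeletal (Δ[m] : SSet.{u}) ∨ IsIso (L.restr.map (boundary.{u} m).ι) := by
  let ε : L.skel.obj (L.restr.obj Δ[m]) ⟶ (Δ[m] : SSet.{u}) := L.skelAdj.counit.app _
  by_cases h : Subcomplex.range ε ≤ boundary m
  · right
    have hfac : Subcomplex.lift ε h ≫ (boundary.{u} m).ι = ε := rfl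
    have h1 : IsIso (L.restr.map ε) := L.isIso_restr_map_skelAdj_counit _
    have h2 : IsSplitEpi (L.restr.map (boundary.{u} m).ι) :=
      ⟨⟨⟨inv (L.restr.map ε) ≫ L.restr.map (Subcomplex.lift ε h), by
        rw [Category.assoc, ← Functor.map_comp, hfac, IsIso.inv_hom_id]⟩⟩⟩
    have := L.skelAdj.rightAdjoint_preservesLimits
    have h3 : Mono (L.restr.map (boundary.{u} m).ι) := inferInstance
    exact isIso_of_mono_of_isSplitEpi _
  · left
    rw [stdSimplex.le_boundary_iff, not_not] at h
    obtain ⟨z, hz⟩ : stdSimplex.objEquiv.symm (𝟙 ⦋m⦌) ∈ (Subcomplex.range ε).obj (op ⦋m⦌) := by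
      rw [h]
      trivial
    refine EssentialSubtopos.isSkeletal_of_section (yonedaEquiv.symm z) ?_
    apply yonedaEquiv.injective
    exact (congrArg yonedaEquiv (yonedaEquiv_symm_comp z ε)).trans
      ((Equiv.apply_symm_apply _ _).trans hz)

/-- If the standard `m`-simplex is skeletal for a level, then a map which is inverted by the level
is bijective in dimensions at most `m`, so the level lies above the level `m`. -/
lemma level_isLowerThan_of_isSkeletal_stdSimplex {L : EssentialSubtopos.{u, u + 1} SSet.{u}}
    {m : ℕ} (h : L.IsSkeletal (Δ[m] : SSet.{u})) : (level.{u} m).IsLowerThan L := by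
  refine EssentialSubtopos.isLowerThan_of_isIso_restr_map fun {Y Z} f hf => ?_
  rw [isIso_level_restr_map_iff]
  intro k hk
  let i : ⦋k⦌ ⟶ ⦋m⦌ := SimplexCategory.Hom.mk (Fin.castLEOrderEmb (Nat.succ_le_succ hk)).toOrderHom
  let r : ⦋m⦌ ⟶ ⦋k⦌ := SimplexCategory.Hom.mk
    { toFun := fun j => ⟨min (j : ℕ) k, Nat.lt_succ_of_le (min_le_right _ _)⟩
      monotone' := fun _ _ h => Fin.mk_le_mk.2 (min_le_min_right k h) }
  have hir : i ≫ r = 𝟙 ⦋k⦌ := by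
    ext j
    exact min_eq_left (Nat.le_of_lt_succ j.isLt)
  have hk : L.IsSkeletal (Δ[k] : SSet.{u}) :=
    h.of_retract (SSet.stdSimplex.map i) (SSet.stdSimplex.map r) (by
      exact (SSet.stdSimplex.map_comp i r).symm.trans
        ((congrArg _ hir).trans (SSet.stdSimplex.map_id _)))
  have h1 : yonedaEquiv ∘ (fun g : Δ[k] ⟶ Y => g ≫ f) = f.app (op ⦋k⦌) ∘ yonedaEquiv := rfl
  rw [← yonedaEquiv.bijective.of_comp_iff, ← h1]
  exact yonedaEquiv.bijective.comp (hk.bijective_comp f)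

end SSet

/-! ### The rank of a simplex, and equality of degenerate simplices -/

namespace SSet

variable {X : SSet.{u}}

lemma exists_rank {m : ℕ} (x : X _⦋m⦌) :
    ∃ (r : ℕ) (f : ⦋m⦌ ⟶ ⦋r⦌) (z : X _⦋r⦌), X.map f.op z = x :=
  ⟨m, 𝟙 _, x, by simp⟩

open Classical in
/-- The rank of a simplex `x`: the least dimension of a simplex of which `x` is the image under
a simplicial operator. It is the dimension of the nondegenerate simplex underlying `x`. -/
noncomputable def rank {m : ℕ} (x : X _⦋m⦌) : ℕ := Nat.find (exists_rank x)

lemma exists_map_eq {m : ℕ} (x : X _⦋m⦌) :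
    ∃ (f : ⦋m⦌ ⟶ ⦋rank x⦌) (z : X _⦋rank x⦌), X.map f.op z = x := by
  classical
  exact Nat.find_spec (exists_rank x)

lemma rank_map_le {m r : ℕ} (f : ⦋m⦌ ⟶ ⦋r⦌) (z : X _⦋r⦌) : rank (X.map f.op z) ≤ r := by
  classical
  exact Nat.find_min' (exists_rank _) ⟨f, z, rfl⟩

lemma rank_map_le_rank {m r : ℕ} (f : ⦋m⦌ ⟶ ⦋r⦌) (x : X _⦋r⦌) :
    rank (X.map f.op x) ≤ rank x := by
  obtain ⟨g, z, hz⟩ := exists_map_eq x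
  have h : X.map (f ≫ g).op z = X.map f.op x := by
    rw [op_comp, Functor.map_comp, comp_apply]
    exact congrArg _ hz
  rw [← h]
  exact rank_map_le _ _

lemma rank_le (n : ℕ) [X.HasDimensionLE n] {m : ℕ} (x : X _⦋m⦌) : rank x ≤ n := by
  obtain ⟨r, f, _, z, rfl⟩ := X.exists_nonDegenerate x
  exact (rank_map_le f z.1).trans (X.dim_le_of_nonDegenerate z n)

/-- The vertex `p` of the simplex `x` is identified with a neighbouring vertex, by a degeneracy
operator through which `x` factors. -/
def Touches {m : ℕ} (x : X _⦋m + 1⦌) (p : Fin (m + 2)) : Prop :=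
  ∃ i : Fin (m + 1), (i.castSucc = p ∨ i.succ = p) ∧ x ∈ Set.range (X.σ i)

lemma touches_of_apply_eq {m : ℕ} {d : SimplexCategory} {f : ⦋m + 1⦌ ⟶ d} {z : X.obj (op d)}
    {p q : Fin (m + 2)} (hpq : p ≠ q) (h : f.toOrderHom p = f.toOrderHom q) :
    Touches (X.map f.op z) p := by
  have key (i : Fin (m + 1)) (hi : f.toOrderHom i.castSucc = f.toOrderHom i.succ) :
      X.map f.op z ∈ Set.range (X.σ i) := by
    obtain ⟨g, rfl⟩ := SimplexCategory.eq_σ_comp_of_not_injective' f i hi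
    exact ⟨X.map g.op z, by simp [SimplicialObject.σ]⟩
  rcases lt_or_gt_of_ne hpq with hlt | hlt
  · obtain ⟨i, rfl⟩ := Fin.exists_castSucc_eq.2 (Fin.ne_last_of_lt hlt)
    refine ⟨i, Or.inl rfl, key i (le_antisymm (f.toOrderHom.monotone (Fin.castSucc_le_succ i)) ?_)⟩
    rw [h]
    exact f.toOrderHom.monotone (Fin.castSucc_lt_iff_succ_le.1 hlt)
  · obtain ⟨i, rfl⟩ := Fin.exists_succ_eq.2 (Fin.ne_zero_of_lt hlt)
    refine ⟨i, Or.inr rfl, key i (le_antisymm (f.toOrderHom.monotone (Fin.castSucc_le_succ i)) ?_)⟩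
    rw [h]
    exact f.toOrderHom.monotone (Fin.le_castSucc_iff.2 hlt)

/-- A set of more than `n` vertices of a simplex which is not the whole simplex contains a vertex
that is identified with another one, when the simplex has rank at most `n`. -/
lemma exists_touches {n : ℕ} [X.HasDimensionLE n] {m : ℕ} (hm : n < m + 1) (x : X _⦋m + 1⦌)
    (F : Finset (Fin (m + 2))) (hF : n + 1 ≤ F.card) : ∃ p ∈ F, Touches x p := by
  have hr := rank_le n x
  obtain ⟨f, z, hz⟩ := exists_map_eq x
  generalize rank x = r at *
  subst hz
  by_cases hinj : Set.InjOn f.toOrderHom (F : Set (Fin (m + 2)))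
  · -- the images of the vertices in `F` exhaust the target, so any other vertex shares its image
    have huniv : F.image f.toOrderHom = Finset.univ := by
      rw [← Finset.card_eq_iff_eq_univ, Finset.card_image_of_injOn hinj]
      have h1 := Finset.card_le_univ (F.image f.toOrderHom)
      rw [Finset.card_image_of_injOn hinj] at h1
      simp only [Fintype.card_fin, SimplexCategory.len_mk] at h1 ⊢
      lia
    obtain ⟨q, hq⟩ : ∃ q, q ∉ F := by
      by_contra! hall
      have h1 : F = Finset.univ := Finset.eq_univ_iff_forall.2 hall
      subst h1
      have h1 := Finset.card_le_card_of_injOn (t := Finset.univ) f.toOrderHom (by simp) hinj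
      simp at h1
      lia
    have hq' : f.toOrderHom q ∈ F.image f.toOrderHom := by simp [huniv]
    obtain ⟨p, hp, hpq⟩ := Finset.mem_image.1 hq'
    exact ⟨p, hp, touches_of_apply_eq (fun h => hq (by rwa [h] at hp)) hpq⟩
  · simp only [Set.InjOn, not_forall] at hinj
    obtain ⟨p, hp, q, hq, h, hne⟩ := hinj
    exact ⟨p, hp, touches_of_apply_eq hne h⟩

lemma Touches.rank_δ {m : ℕ} {x : X _⦋m + 1⦌} {p : Fin (m + 2)} (h : Touches x p) :
    rank (X.δ p x) = rank x := by
  obtain ⟨i, hi, y, rfl⟩ := h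
  have h1 : X.δ p (X.σ i y) = y := by
    rcases hi with rfl | rfl
    · exact δ_comp_σ_self_apply i y
    · exact δ_comp_σ_succ_apply i y
  refine le_antisymm (rank_map_le_rank _ _) ?_
  rw [h1]
  exact rank_map_le_rank _ _

/-- Deleting a vertex that is not joined to a neighbour lowers the rank. -/
lemma touches_of_rank_le {m : ℕ} {x : X _⦋m + 1⦌} {p : Fin (m + 2)}
    (h : rank x ≤ rank (X.δ p x)) : Touches x p := by
  obtain ⟨f, z, hz⟩ := exists_map_eq x
  generalize hr : rank x = r at *
  subst hz
  by_cases hs : Function.Surjective (SimplexCategory.δ p ≫ f).toOrderHom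
  · obtain ⟨q, hq⟩ := hs (f.toOrderHom p)
    exact touches_of_apply_eq (Fin.succAbove_ne p q).symm hq.symm
  · exfalso
    obtain _ | r := r
    · exact hs fun a => ⟨0, Subsingleton.elim (α := Fin 1) _ _⟩
    · obtain ⟨i, g, hg⟩ := SimplexCategory.eq_comp_δ_of_not_surjective _ hs
      have h1 : X.δ p (X.map f.op z) = X.map g.op (X.δ i z) := by
        simp only [SimplicialObject.δ, ← comp_apply, ← Functor.map_comp, ← op_comp, hg]
      rw [h1] at h
      have := rank_map_le g (X.δ i z)
      lia

/-- Let two simplices `x` and `y` have the same faces at the indices in `F`, where `y` is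
degenerate along two consecutive vertices in `F` and `x` is degenerate along two consecutive
vertices of which at least one is in `F`. Then they are equal. -/
lemma eq_of_mem_range_σ {m : ℕ} {x y : X _⦋m + 1⦌} (F : Set (Fin (m + 2)))
    (hF : ∀ p ∈ F, X.δ p x = X.δ p y) {b : Fin (m + 1)} (hb : b.castSucc ∈ F)
    (hb' : b.succ ∈ F) (hy : y ∈ Set.range (X.σ b)) {a : Fin (m + 1)}
    (ha : a.castSucc ∈ F ∨ a.succ ∈ F) (hx : x ∈ Set.range (X.σ a)) : x = y := by
  obtain ⟨β, rfl⟩ := hy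
  obtain ⟨α, rfl⟩ := hx
  have h1 := hF _ hb
  have h2 := hF _ hb'
  rw [δ_comp_σ_self_apply] at h1
  rw [δ_comp_σ_succ_apply] at h2
  -- it suffices that `y` factors through the same degeneracy operator as `x`
  have key (ζ) (h : X.σ b β = X.σ a ζ) : X.σ a α = X.σ b β := by
    rw [h] at hF ⊢
    rcases ha with ha | ha
    · have := hF _ ha
      rw [δ_comp_σ_self_apply, δ_comp_σ_self_apply] at this
      rw [this]
    · have := hF _ ha
      rw [δ_comp_σ_succ_apply, δ_comp_σ_succ_apply] at this
      rw [this]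
  obtain _ | m := m
  · obtain rfl : a = b := Subsingleton.elim (α := Fin 1) _ _
    exact key β rfl
  rcases lt_trichotomy a b with hab | rfl | hab
  · obtain ⟨a, rfl⟩ := Fin.exists_castSucc_eq.2 (Fin.ne_last_of_lt hab)
    obtain ⟨b, rfl⟩ := Fin.exists_succ_eq.2 (Fin.ne_zero_of_lt hab)
    rcases eq_or_lt_of_le (Fin.le_castSucc_iff.2 hab : a.castSucc ≤ b.castSucc) with h | h
    · obtain rfl := Fin.castSucc_injective _ h
      rw [← Fin.succ_castSucc, δ_comp_σ_succ_apply] at h1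
      rw [δ_comp_σ_of_gt_apply Fin.castSucc_lt_succ] at h2
      refine key β ?_
      rw [← h2, σ_comp_σ_apply le_rfl]
    · rw [← Fin.succ_castSucc, δ_comp_σ_of_gt_apply h] at h1
      refine key (X.σ b (X.δ b.castSucc α)) ?_
      rw [← h1, ← σ_comp_σ_apply (Fin.castSucc_le_castSucc_iff.1 h.le)]
  · exact key β rfl
  · obtain ⟨b, rfl⟩ := Fin.exists_castSucc_eq.2 (Fin.ne_last_of_lt hab)
    obtain ⟨a, rfl⟩ := Fin.exists_succ_eq.2 (Fin.ne_zero_of_lt hab)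
    have h : b ≤ a := Fin.castSucc_le_castSucc_iff.1 (Fin.le_castSucc_iff.2 hab)
    rw [δ_comp_σ_of_le_apply (Fin.castSucc_le_castSucc_iff.2 h)] at h1
    refine key (X.σ b (X.δ b.castSucc α)) ?_
    rw [← h1, σ_comp_σ_apply h]

end SSet

/-! ### Fillers of spheres in simplicial sets of dimension at most `n` -/

namespace SSet

variable {X : SSet.{u}}

/-- The sphere relation without ordering of the indices: the `p`-th face of the `t`-th simplex is
a face of the simplex whose index is the `p`-th element different from `t`. -/
lemma exists_δ_eq_of_isSphere {m : ℕ} (t : Fin (m + 3)) (p : Fin (m + 2)) :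
    ∃ q : Fin (m + 2), ∀ c : Fin (m + 3) → X _⦋m + 1⦌, IsSphere c →
      X.δ p (c t) = X.δ q (c (t.succAbove p)) := by
  rcases lt_or_ge p.castSucc t with h | h
  · obtain ⟨q, rfl⟩ := Fin.exists_succ_eq.2 (Fin.ne_zero_of_lt h)
    refine ⟨q, fun c hc => ?_⟩
    rw [Fin.succAbove_of_castSucc_lt _ _ h]
    exact hc p q (Fin.castSucc_le_castSucc_iff.1 (Fin.le_castSucc_iff.2 h))
  · obtain ⟨q, rfl⟩ := Fin.exists_castSucc_eq.2
      (Fin.ne_last_of_lt (lt_of_le_of_lt h (Fin.castSucc_lt_last p)))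
    refine ⟨q, fun c hc => ?_⟩
    rw [Fin.succAbove_of_le_castSucc _ _ h]
    exact (hc q p (Fin.castSucc_le_castSucc_iff.1 h)).symm

/-- Deleting a vertex `t` preserves a degeneracy along two consecutive vertices other than `t`. -/
lemma exists_δ_mem_range_σ {m : ℕ} {y : X _⦋m + 2⦌} {b : Fin (m + 2)}
    (hy : y ∈ Set.range (X.σ b)) {t : Fin (m + 3)} (ht : t ≠ b.castSucc) (ht' : t ≠ b.succ) :
    ∃ a : Fin (m + 1), t.succAbove a.castSucc = b.castSucc ∧ t.succAbove a.succ = b.succ ∧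
      X.δ t y ∈ Set.range (X.σ a) := by
  obtain ⟨x, rfl⟩ := hy
  rcases lt_or_gt_of_ne ht with h | h
  · obtain ⟨s, rfl⟩ := Fin.exists_castSucc_eq.2 (Fin.ne_last_of_lt h)
    rw [Fin.castSucc_lt_castSucc_iff] at h
    obtain ⟨a, rfl⟩ := Fin.exists_succ_eq.2 (Fin.ne_zero_of_lt h)
    have h' : s ≤ a.castSucc := Fin.le_castSucc_iff.2 h
    refine ⟨a, ?_, ?_, X.δ s x, (δ_comp_σ_of_le_apply h' x).symm⟩
    · rw [Fin.succAbove_of_le_castSucc _ _ (Fin.castSucc_le_castSucc_iff.2 h'),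
        Fin.succ_castSucc]
    · rw [Fin.succAbove_of_le_castSucc _ _ (Fin.castSucc_le_castSucc_iff.2 h.le)]
  · obtain ⟨s, rfl⟩ := Fin.exists_succ_eq.2 (Fin.ne_zero_of_lt h)
    have h' : b < s := lt_of_le_of_ne (Fin.castSucc_le_castSucc_iff.1 (Fin.le_castSucc_iff.2 h))
      (fun h => ht' (congrArg Fin.succ h.symm))
    obtain ⟨a, rfl⟩ := Fin.exists_castSucc_eq.2 (Fin.ne_last_of_lt h')
    refine ⟨a, ?_, ?_, X.δ s x, (δ_comp_σ_of_gt_apply h' x).symm⟩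
    · rw [Fin.succAbove_of_castSucc_lt _ _ h]
    · rw [Fin.succAbove_of_castSucc_lt, Fin.succ_castSucc]
      rw [Fin.castSucc_lt_succ_iff]
      exact Fin.castSucc_lt_iff_succ_le.1 h'

/-- Simplices of dimension greater than `n`, which are degenerate, are determined by their
faces. -/
lemma eq_of_forall_δ_eq {n : ℕ} [X.HasDimensionLE n] {m : ℕ} (hm : n < m + 1) {x y : X _⦋m + 1⦌}
    (h : ∀ p, X.δ p x = X.δ p y) : x = y := by
  have hdeg (z : X _⦋m + 1⦌) : ∃ i, z ∈ Set.range (X.σ i) := by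
    have : z ∈ X.degenerate (m + 1) := by
      simp [X.degenerate_eq_univ_of_hasDimensionLT (n + 1) (m + 1) (by lia)]
    rwa [degenerate_eq_iUnion_range_σ, Set.mem_iUnion] at this
  obtain ⟨a, ha⟩ := hdeg x
  obtain ⟨b, hb⟩ := hdeg y
  exact eq_of_mem_range_σ Set.univ (fun p _ => h p) trivial trivial hb (Or.inl trivial) ha

/-- In a simplicial set of dimension at most `n`, let `y` have the same faces as a sphere `c` at
a set `F` of more than `n` indices, and let it be degenerate at two consecutive indices in `F`.
Then `y` fills `c`. -/
lemma IsSphere.fills_of_mem {n : ℕ} [X.HasDimensionLE n] {m : ℕ} (hm : n < m + 1)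
    {c : Fin (m + 3) → X _⦋m + 1⦌} (hc : IsSphere c) {y : X _⦋m + 2⦌} (F : Finset (Fin (m + 3)))
    (hF : n + 1 ≤ F.card) (hy : ∀ t ∈ F, X.δ t y = c t) {b : Fin (m + 2)}
    (hb : b.castSucc ∈ F) (hb' : b.succ ∈ F) (hyb : y ∈ Set.range (X.σ b)) : Fills y c := by
  intro t
  by_cases ht : t ∈ F
  · exact hy t ht
  let G : Finset (Fin (m + 2)) := {p | t.succAbove p ∈ F}
  have hG : G.map t.succAboveEmb = F := by
    ext s
    simp only [G, Finset.mem_map, Finset.mem_filter, Finset.mem_univ, true_and]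
    constructor
    · rintro ⟨p, hp, rfl⟩
      exact hp
    · intro hs
      obtain ⟨p, rfl⟩ := Fin.exists_succAbove_eq (fun h => ht (h ▸ hs) : s ≠ t)
      exact ⟨p, hs, rfl⟩
  rw [← hG, Finset.card_map] at hF
  obtain ⟨p, hp, i, hi, hci⟩ := exists_touches hm (c t) G hF
  obtain ⟨a, ha, ha', hya⟩ := exists_δ_mem_range_σ hyb (t := t)
    (fun h => ht (h ▸ hb)) (fun h => ht (h ▸ hb'))
  refine (eq_of_mem_range_σ (G : Set (Fin (m + 2))) (fun p hp => ?_) (b := a) (a := i)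
    (by simpa [G, ha]) (by simpa [G, ha']) hya ?_ hci).symm
  · obtain ⟨q, hq⟩ := exists_δ_eq_of_isSphere (X := X) t p
    rw [hq c hc, ← hy _ (by simpa [G] using hp)]
    exact (hq _ (isSphere_δ y)).symm
  · rcases hi with rfl | rfl
    · exact Or.inl hp
    · exact Or.inr hp

/-- In a simplicial set of dimension at most `n`, spheres of dimension at least `2 n` have
fillers. Among the simplices `c t` of maximal rank, take the one with the least index `j`; then
`σ j (c j)` is a filler. -/
lemma IsSphere.exists_fills_of_hasDimensionLE {n : ℕ} [X.HasDimensionLE n] (hn : 2 ≤ n) {m : ℕ}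
    (hm : 2 * n ≤ m + 2) {c : Fin (m + 3) → X _⦋m + 1⦌} (hc : IsSphere c) :
    ∃ y, Fills y c := by
  classical
  obtain ⟨t₀, -, ht₀⟩ := Finset.exists_max_image Finset.univ (fun t => rank (c t))
    ⟨0, Finset.mem_univ 0⟩
  generalize hr : rank (c t₀) = r at ht₀
  let M : Finset (Fin (m + 3)) := {t | rank (c t) = r}
  have hM {t : Fin (m + 3)} : t ∈ M ↔ rank (c t) = r := by simp [M]
  -- the neighbours of an index of maximal rank have maximal rank
  have hMem {t : Fin (m + 3)} (ht : t ∈ M) {p : Fin (m + 2)} (hp : Touches (c t) p) :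
      t.succAbove p ∈ M := by
    obtain ⟨q, hq⟩ := exists_δ_eq_of_isSphere (X := X) t p
    refine hM.2 (le_antisymm (ht₀ _ (Finset.mem_univ _)) ?_)
    rw [← hM.1 ht, ← hp.rank_δ, hq c hc]
    exact rank_map_le_rank _ _
  obtain ⟨j₀, hj₀, hmin⟩ := M.exists_min_image id ⟨t₀, hM.2 hr⟩
  simp only [id] at hmin
  have hle {p : Fin (m + 2)} (hp : Touches (c j₀) p) : j₀ ≤ p.castSucc := by
    by_contra! h
    have := hmin _ (hMem hj₀ hp)
    rw [Fin.succAbove_of_castSucc_lt _ _ h] at this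
    exact absurd h this.not_gt
  obtain ⟨p₀, -, i₀, hi₀, hci₀⟩ := exists_touches (n := n) (by lia) (c j₀) Finset.univ
    (by simp; lia)
  obtain ⟨j, rfl⟩ := Fin.exists_castSucc_eq.2
    (Fin.ne_last_of_lt (lt_of_le_of_lt (hle ⟨i₀, hi₀, hci₀⟩) (Fin.castSucc_lt_last p₀)))
  simp only [Fin.castSucc_le_castSucc_iff] at hle
  have hji₀ : j ≤ i₀.castSucc := hle ⟨i₀, Or.inl rfl, hci₀⟩
  obtain ⟨i, rfl⟩ := Fin.exists_castSucc_eq.2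
    (Fin.ne_last_of_lt (lt_of_le_of_lt hji₀ (Fin.castSucc_lt_last i₀)))
  rw [Fin.castSucc_le_castSucc_iff] at hji₀
  have hsucc {p : Fin (m + 2)} (hp : Touches (c i.castSucc.castSucc) p) :
      i.castSucc.castSucc.succAbove p = p.succ :=
    Fin.succAbove_of_le_castSucc _ _ (Fin.castSucc_le_castSucc_iff.2 (hle hp))
  -- by minimality, the vertex `i` of a simplex of maximal rank can only be joined to the next one
  have hσ {x : X _⦋m + 1⦌} (hx : Touches x i.castSucc)
      (hx' : ∀ k : Fin (m + 1), k.castSucc < i.castSucc → ¬ Touches x k.castSucc) :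
      X.σ i (X.δ i.castSucc x) = x := by
    obtain ⟨k, hk, hxk⟩ := hx
    rcases hk with hk | hk
    · obtain rfl := Fin.castSucc_injective _ hk
      obtain ⟨w, rfl⟩ := hxk
      rw [δ_comp_σ_self_apply]
    · exact absurd ⟨k, Or.inl rfl, hxk⟩ (hx' k (hk ▸ Fin.castSucc_lt_succ))
  have hnot {t : Fin (m + 3)} (ht : t ∈ M) (hit : i.castSucc.castSucc ≤ t) (k : Fin (m + 1))
      (hk : k.castSucc < i.castSucc) : ¬ Touches (c t) k.castSucc := by
    intro h
    have h1 := hmin _ (hMem ht h)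
    rw [← Fin.castSucc_lt_castSucc_iff] at hk
    rw [Fin.succAbove_of_castSucc_lt _ _ (lt_of_lt_of_le hk hit)] at h1
    exact absurd hk h1.not_gt
  -- `y = σ i (c i)` has the right face at the vertices that are joined to a neighbour in `c i`
  have hface {p : Fin (m + 2)} (hp : Touches (c i.castSucc.castSucc) p) :
      X.δ p.succ (X.σ i.castSucc (c i.castSucc.castSucc)) = c p.succ := by
    have hpM : p.succ ∈ M := hsucc hp ▸ hMem hj₀ hp
    have hip := hle hp
    have hs : X.δ i.castSucc (c p.succ) = X.δ p (c i.castSucc.castSucc) := hc _ _ hip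
    have h1 : X.σ i (X.δ i.castSucc (c p.succ)) = c p.succ := by
      refine hσ (touches_of_rank_le ?_) (hnot hpM ((Fin.castSucc_le_castSucc_iff.2 hip).trans
        (Fin.castSucc_le_succ p)))
      rw [hs, hp.rank_δ, hM.1 hj₀, hM.1 hpM]
    rcases eq_or_lt_of_le hip with rfl | hlt
    · rw [δ_comp_σ_succ_apply, ← h1, hs, hσ hp (hnot hj₀ le_rfl)]
    · rw [δ_comp_σ_of_gt_apply hlt, ← hs, h1]
  -- all but at most `n` of the `m + 2` vertices of `c i` are joined to a neighbour
  let S : Finset (Fin (m + 2)) := {p | Touches (c i.castSucc.castSucc) p}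
  have hS {p : Fin (m + 2)} : p ∈ S ↔ Touches (c i.castSucc.castSucc) p := by simp [S]
  have hcard : m + 2 ≤ S.card + n := by
    by_contra! h
    have h1 := S.card_add_card_compl
    rw [Fintype.card_fin] at h1
    obtain ⟨p, hp, hp'⟩ := exists_touches (n := n) (by lia) (c i.castSucc.castSucc) Sᶜ (by lia)
    exact Finset.mem_compl.1 hp (hS.2 hp')
  have hjS : i.castSucc.castSucc ∉ S.map (Fin.succEmb _) := by
    simp only [Finset.mem_map, not_exists, not_and]
    intro p hp h
    have := hle (hS.1 hp)
    simp only [Fin.ext_iff, Fin.le_def, Fin.val_castSucc, Fin.coe_succEmb, Fin.val_succ] at h this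
    lia
  refine ⟨_, hc.fills_of_mem (by lia) (insert i.castSucc.castSucc (S.map (Fin.succEmb _)))
    (y := X.σ i.castSucc (c i.castSucc.castSucc)) (b := i₀.succ) (n := n) ?_ ?_ ?_ ?_ ?_⟩
  · rw [Finset.card_insert_of_notMem hjS, Finset.card_map]
    lia
  · intro t ht
    rcases Finset.mem_insert.1 ht with rfl | ht
    · exact δ_comp_σ_self_apply _ _
    · obtain ⟨p, hp, rfl⟩ := Finset.mem_map.1 ht
      exact hface (hS.1 hp)
  · exact Finset.mem_insert_of_mem
      (Finset.mem_map.2 ⟨i₀.castSucc, hS.2 ⟨i₀, Or.inl rfl, hci₀⟩, Fin.succ_castSucc _⟩)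
  · exact Finset.mem_insert_of_mem
      (Finset.mem_map.2 ⟨i₀.succ, hS.2 ⟨i₀, Or.inr rfl, hci₀⟩, rfl⟩)
  · obtain ⟨w, hw⟩ := hci₀
    exact ⟨X.σ i w, by rw [← hw, σ_comp_σ_apply hji₀]⟩

lemma IsSphere.existsUnique_fills {n : ℕ} [X.HasDimensionLE n] (hn : 2 ≤ n) {m : ℕ}
    (hm : 2 * n ≤ m + 2) {c : Fin (m + 3) → X _⦋m + 1⦌} (hc : IsSphere c) :
    ∃! y, Fills y c := by
  obtain ⟨y, hy⟩ := hc.exists_fills_of_hasDimensionLE hn hm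
  exact ⟨y, hy, fun z hz => eq_of_forall_δ_eq (n := n) (by lia)
    fun p => (hz p).trans (hy p).symm⟩

end SSet

/-! ### A wedge of two simplices modulo horns -/

namespace SSet

/-- The vertex of `Δ[p + 2]` opposite to the only face that survives in the quotient by the
horn: the vertex `0` for the first summand (`true`), the last one for the second (`false`). -/
def hornApex (p : ℕ) (b : Bool) : Fin (p + 3) := if b then 0 else Fin.last (p + 2)

/-- A simplex of one of two copies of `Δ[p + 2]` that belongs to the horn to be collapsed. -/
def IsCollapsed {p : ℕ} {d : SimplexCategoryᵒᵖ} (s : Bool × (Δ[p + 2] : SSet.{u}).obj d) : Prop :=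
  s.2 ∈ (horn.{u} (p + 2) (hornApex p s.1)).obj d

/-- The equivalence relation that identifies all simplices of the two horns. -/
def hornWedgeSetoid (p : ℕ) (d : SimplexCategoryᵒᵖ) :
    Setoid (Bool × (Δ[p + 2] : SSet.{u}).obj d) where
  r s t := s = t ∨ (IsCollapsed s ∧ IsCollapsed t)
  iseqv :=
    { refl := fun _ => Or.inl rfl
      symm := by
        rintro s t (h | h)
        exacts [Or.inl h.symm, Or.inr h.symm]
      trans := by
        rintro s t w (rfl | h) (rfl | h')
        exacts [Or.inl rfl, Or.inr h', Or.inr h, Or.inr ⟨h.1, h'.2⟩] }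

/-- The wedge of `Δ[n] / Λ[n, 0]` and `Δ[n] / Λ[n, n]` for `n = p + 2`. -/
def hornWedge (p : ℕ) : SSet.{u} where
  obj d := Quotient (hornWedgeSetoid.{u} p d)
  map φ := ↾(Quotient.map (fun s => (s.1, (Δ[p + 2] : SSet.{u}).map φ s.2)) (by
    rintro s t (rfl | h)
    · exact Or.inl rfl
    · exact Or.inr ⟨Subfunctor.map _ φ h.1, Subfunctor.map _ φ h.2⟩))
  map_id d := by
    ext ⟨s⟩
    exact congrArg (Quotient.mk _) (Prod.ext rfl (congrArg (fun g => g s.2)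
      ((Δ[p + 2] : SSet.{u}).map_id d)))
  map_comp φ ψ := by
    ext ⟨s⟩
    rfl

namespace hornWedge

variable {p : ℕ}

/-- The simplex of the wedge that is represented by a simplex of one of the summands. -/
def mk {m : ℕ} (b : Bool) (f : ⦋m⦌ ⟶ ⦋p + 2⦌) : (hornWedge.{u} p) _⦋m⦌ :=
  Quotient.mk (hornWedgeSetoid p (op ⦋m⦌)) (b, stdSimplex.objEquiv.symm f)

/-- The map `f` represents a simplex of the horn of the summand `b`: it misses a vertex other than
the apex. -/
def Misses {m : ℕ} (b : Bool) (f : ⦋m⦌ ⟶ ⦋p + 2⦌) : Prop :=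
  ∃ j, j ≠ hornApex p b ∧ ∀ i, f.toOrderHom i ≠ j

lemma map_mk {m k : ℕ} (g : ⦋k⦌ ⟶ ⦋m⦌) (b : Bool) (f : ⦋m⦌ ⟶ ⦋p + 2⦌) :
    (hornWedge.{u} p).map g.op (mk b f) = mk b (g ≫ f) := rfl

lemma map_mk_id {m : ℕ} (b : Bool) (f : ⦋m⦌ ⟶ ⦋p + 2⦌) :
    (hornWedge.{u} p).map f.op (mk b (𝟙 _)) = mk b f := by
  rw [map_mk, Category.comp_id]

lemma δ_mk {m : ℕ} (i : Fin (m + 2)) (b : Bool) (f : ⦋m + 1⦌ ⟶ ⦋p + 2⦌) :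
    (hornWedge.{u} p).δ i (mk b f) = mk b (SimplexCategory.δ i ≫ f) := rfl

lemma exists_mk {m : ℕ} (x : (hornWedge.{u} p) _⦋m⦌) : ∃ b f, mk b f = x := by
  obtain ⟨⟨b, f⟩, rfl⟩ := Quotient.exists_rep x
  exact ⟨b, stdSimplex.objEquiv f, rfl⟩

lemma mk_eq_mk_iff {m : ℕ} {b b' : Bool} {f g : ⦋m⦌ ⟶ ⦋p + 2⦌} :
    mk.{u} b f = mk b' g ↔ (b = b' ∧ f = g) ∨ (Misses b f ∧ Misses b' g) := by
  have h (b : Bool) (f : ⦋m⦌ ⟶ ⦋p + 2⦌) :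
      IsCollapsed.{u} (b, stdSimplex.objEquiv.symm f) ↔ Misses b f := by
    refine (mem_horn_iff_notMem_range _ _).trans (exists_congr fun j => ?_)
    exact ⟨fun ⟨hj, h⟩ => ⟨hj, fun i hi => h ⟨i, hi⟩⟩, fun ⟨hj, h⟩ => ⟨hj, fun ⟨i, hi⟩ => h i hi⟩⟩
  rw [← h, ← h]
  refine Quotient.eq.trans ?_
  change _ = _ ∨ _ ↔ _
  rw [Prod.mk.injEq, stdSimplex.objEquiv.symm.injective.eq_iff]

lemma Misses.comp {m k : ℕ} {b : Bool} {f : ⦋m⦌ ⟶ ⦋p + 2⦌} (h : Misses b f) (g : ⦋k⦌ ⟶ ⦋m⦌) :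
    Misses b (g ≫ f) := by
  obtain ⟨j, hj, h⟩ := h
  exact ⟨j, hj, fun i => h _⟩

variable (p) in
/-- The common vertex of the two summands. -/
def base : (hornWedge.{u} p) _⦋0⦌ := mk true (SimplexCategory.const ⦋0⦌ ⦋p + 2⦌ 0)

lemma mk_eq_degenerateAt {m : ℕ} {b : Bool} {f : ⦋m⦌ ⟶ ⦋p + 2⦌} (h : Misses b f) :
    mk.{u} b f = degenerateAt (base p) m := by
  have h0 : Misses (p := p) true (SimplexCategory.const ⦋0⦌ ⦋p + 2⦌ 0) :=
    ⟨1, one_ne_zero, fun _ => zero_ne_one⟩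
  exact mk_eq_mk_iff.2 (Or.inr ⟨h, h0.comp _⟩)

lemma mk_mem_nonDegenerate {m : ℕ} {b : Bool} {f : ⦋m⦌ ⟶ ⦋p + 2⦌}
    (hf : Function.Injective f.toOrderHom) (h : ¬ Misses b f) :
    mk.{u} b f ∈ (hornWedge.{u} p).nonDegenerate m := by
  rintro ⟨k, hk, g, y, hy⟩
  obtain ⟨b', f', rfl⟩ := exists_mk y
  rw [map_mk, mk_eq_mk_iff] at hy
  obtain ⟨-, rfl⟩ | hy := hy
  · have hg : Function.Injective g.toOrderHom := Function.Injective.of_comp hf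
    have := Fintype.card_le_of_injective _ hg
    simp at this
    lia
  · exact h hy.2

instance : (hornWedge.{u} p).HasDimensionLE (p + 2) where
  degenerate_eq_top m hm := by
    rw [Set.top_eq_univ, Set.eq_univ_iff_forall]
    intro x
    obtain ⟨b, f, rfl⟩ := exists_mk x
    exact ⟨p + 2, by lia, f, mk b (𝟙 _), map_mk_id b f⟩

lemma not_misses_of_surjective {m : ℕ} {b : Bool} {f : ⦋m⦌ ⟶ ⦋p + 2⦌}
    (hf : Function.Surjective f.toOrderHom) : ¬ Misses b f := by
  rintro ⟨j, -, h⟩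
  obtain ⟨i, hi⟩ := hf j
  exact h i hi

lemma not_misses_id {b : Bool} : ¬ Misses b (𝟙 ⦋p + 2⦌) :=
  not_misses_of_surjective Function.surjective_id

lemma not_misses_δ_hornApex (b : Bool) :
    ¬ Misses b (SimplexCategory.δ (hornApex p b)) := by
  rintro ⟨j, hj, h⟩
  obtain ⟨i, hi⟩ := Fin.exists_succAbove_eq hj
  exact h i hi

lemma misses_δ {b : Bool} {i : Fin (p + 3)} (hi : i ≠ hornApex p b) :
    Misses b (SimplexCategory.δ i) :=
  ⟨i, hi, Fin.succAbove_ne i⟩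

lemma misses_δ_comp_δ_hornApex (b : Bool) (i : Fin (p + 2)) :
    Misses b (SimplexCategory.δ i ≫ SimplexCategory.δ (hornApex p b)) :=
  ⟨(hornApex p b).succAbove i, Fin.succAbove_ne _ _, fun k h =>
    Fin.succAbove_ne i k (Fin.succAbove_right_injective h)⟩

lemma isGeneratedByPair :
    IsGeneratedByPair (base.{u} p) (mk true (SimplexCategory.δ 0))
      (mk false (SimplexCategory.δ (Fin.last (p + 2)))) (mk true (𝟙 _)) (mk false (𝟙 _)) where
  generated := by
    refine le_antisymm le_top fun d z _ => ?_
    induction d with | _ d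
    induction d using SimplexCategory.rec with | _ m
    obtain ⟨b, f, rfl⟩ := exists_mk z
    cases b
    · exact (le_sup_right : _ ≤ _ ⊔ Subcomplex.ofSimplex (mk.{u} false (𝟙 ⦋p + 2⦌))) _
        ⟨f.op, map_mk_id _ f⟩
    · refine (le_sup_left : _ ≤ _ ⊔ Subcomplex.ofSimplex (mk.{u} false (𝟙 ⦋p + 2⦌))) _ ?_
      exact (le_sup_right : _ ≤ _ ⊔ Subcomplex.ofSimplex (mk.{u} true (𝟙 ⦋p + 2⦌))) _
        ⟨f.op, map_mk_id _ f⟩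
  nonDegenerate_x' :=
    mk_mem_nonDegenerate (Fin.succAbove_right_injective (p := 0))
      (not_misses_δ_hornApex true)
  nonDegenerate_y' :=
    mk_mem_nonDegenerate (Fin.succAbove_right_injective (p := (Fin.last _)))
      (not_misses_δ_hornApex false)
  nonDegenerate_x :=
    mk_mem_nonDegenerate Function.injective_id not_misses_id
  nonDegenerate_y :=
    mk_mem_nonDegenerate Function.injective_id not_misses_id
  x'_ne_y' h := by
    obtain ⟨h, -⟩ | h := mk_eq_mk_iff.1 h
    · exact absurd h (by decide)
    · exact not_misses_δ_hornApex true h.1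
  x_ne_y h := by
    obtain ⟨h, -⟩ | h := mk_eq_mk_iff.1 h
    · exact absurd h (by decide)
    · exact not_misses_id h.1
  face_x' i := mk_eq_degenerateAt (misses_δ_comp_δ_hornApex true i)
  face_y' i := mk_eq_degenerateAt (misses_δ_comp_δ_hornApex false i)
  face_zero_x := rfl
  face_last_y := rfl
  face_x i hi := mk_eq_degenerateAt (misses_δ (b := true) hi)
  face_y i hi := mk_eq_degenerateAt (misses_δ (b := false) hi)

lemma collapseFirst_surjective : Function.Surjective (collapseFirst p).toOrderHom := fun j =>
  ⟨⟨j + p, by have := j.isLt; simp at this ⊢; lia⟩, Fin.ext (Nat.add_sub_cancel _ _)⟩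

lemma collapseLast_surjective : Function.Surjective (collapseLast p).toOrderHom := fun j =>
  ⟨⟨j, by have := j.isLt; simp at this ⊢; lia⟩, Fin.ext (min_eq_left (Nat.le_of_lt_succ j.isLt))⟩

lemma pairSphere_eq (i : Fin (2 * p + 4)) :
    pairSphere (X := hornWedge.{u} p) (mk true (𝟙 _)) (mk false (𝟙 _)) i =
      if (i : ℕ) < p + 2 then mk true (collapseFirst p) else mk false (collapseLast p) := by
  rw [pairSphere, map_mk_id, map_mk_id]

lemma isSphere_pairSphere :
    IsSphere (m := 2 * p + 1)
      (pairSphere (X := hornWedge.{u} p) (mk true (𝟙 _)) (mk false (𝟙 _))) := by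
  intro i j hij
  have hij' : (i : ℕ) ≤ (j : ℕ) := hij
  have hval (k : Fin (2 * p + 3)) (l : Fin (2 * p + 2)) :
      ((k.succAbove l : Fin (2 * p + 3)) : ℕ) = if (l : ℕ) < k then (l : ℕ) else l + 1 := by
    simp only [Fin.succAbove, Fin.lt_def, Fin.val_castSucc]
    split_ifs <;> rfl
  rw [pairSphere_eq, pairSphere_eq]
  simp only [Fin.val_succ, Fin.val_castSucc]
  split_ifs with h1 h2 h2
  · rw [δ_mk, δ_mk]
    congr 1
    ext k : 3
    apply Fin.ext
    change ((i.succAbove k : Fin (2 * p + 3)) : ℕ) - p = ((j.succAbove k : Fin (2 * p + 3)) : ℕ) - p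
    rw [hval, hval]
    split_ifs <;> lia
  · lia
  · rw [δ_mk, δ_mk, mk_eq_degenerateAt, mk_eq_degenerateAt]
    · refine ⟨⟨j - p, ?_⟩, ?_, fun k hk => ?_⟩
      · have := j.isLt
        lia
      · intro h
        have := congrArg Fin.val h
        simp [hornApex] at this
        lia
      · have := congrArg Fin.val hk
        change ((j.succAbove k : Fin (2 * p + 3)) : ℕ) - p = j - p at this
        rw [hval] at this
        split_ifs at this <;> lia
    · refine ⟨⟨i, by lia⟩, ?_, fun k hk => ?_⟩
      · intro h
        have := congrArg Fin.val h
        simp [hornApex] at this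
        lia
      · have := congrArg Fin.val hk
        change min ((i.succAbove k : Fin (2 * p + 3)) : ℕ) (p + 2) = i at this
        rw [hval] at this
        split_ifs at this <;> lia
  · rw [δ_mk, δ_mk]
    congr 1
    ext k : 3
    apply Fin.ext
    change min ((i.succAbove k : Fin (2 * p + 3)) : ℕ) (p + 2) =
      min ((j.succAbove k : Fin (2 * p + 3)) : ℕ) (p + 2)
    rw [hval, hval]
    split_ifs <;> lia

lemma not_exists_fills_pairSphere :
    ¬ ∃ z : (hornWedge.{u} p) _⦋2 * p + 3⦌, Fills (m := 2 * p + 1) z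
      (pairSphere (X := hornWedge.{u} p) (mk true (𝟙 _)) (mk false (𝟙 _))) := by
  rintro ⟨z, hz⟩
  obtain ⟨b, f, rfl⟩ := exists_mk z
  have h1 := hz 0
  have h2 := hz (Fin.last _)
  rw [pairSphere_eq, δ_mk] at h1 h2
  rw [if_pos (by simp), mk_eq_mk_iff] at h1
  rw [if_neg (by simp; lia), mk_eq_mk_iff] at h2
  have h1 := h1.resolve_right fun h => not_misses_of_surjective collapseFirst_surjective h.2
  have h2 := h2.resolve_right fun h => not_misses_of_surjective collapseLast_surjective h.2
  exact absurd (h1.1.symm.trans h2.1) (by decide)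

end hornWedge

end SSet

theorem theorem3 :
    (∀ n : ℕ, 2 ≤ n →
      (SSet.level.{u} n).IsAufhebung (SSet.level.{u} (2 * n - 1))) ∧
    (∀ n : ℕ, 2 ≤ n → ∀ X : SSet.{u}, (SSet.level.{u} n).IsSkeletal X →
      (SSet.level.{u} (2 * n - 1)).IsCoskeletal X ∧
      ∀ m : ℕ, 2 * n - 1 < m + 2 → ∀ c : Fin (m + 3) → X _⦋m + 1⦌, SSet.IsSphere c →
        ∃! y : X _⦋m + 2⦌, SSet.Fills y c) ∧
    (∀ n p : ℕ, 3 ≤ n → n = p + 2 →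
      ∃ (X : SSet.{u}) (v : X _⦋0⦌) (x' y' : X _⦋p + 1⦌) (x y : X _⦋p + 2⦌),
        SSet.IsGeneratedByPair v x' y' x y ∧
        (SSet.level.{u} n).IsSkeletal X ∧
        SSet.IsSphere (m := 2 * p + 1) (SSet.pairSphere x y) ∧
        (¬ ∃ z : X _⦋2 * p + 3⦌, SSet.Fills (m := 2 * p + 1) z (SSet.pairSphere x y)) ∧
        ¬ (SSet.level.{u} (2 * n - 2)).IsCoskeletal X) := by
  have hfill (n : ℕ) (hn : 2 ≤ n) (X : SSet.{u}) (hX : (SSet.level.{u} n).IsSkeletal X) (m : ℕ)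
      (hm : 2 * n - 1 < m + 2) (c : Fin (m + 3) → X _⦋m + 1⦌) (hc : SSet.IsSphere c) :
      ∃! y : X _⦋m + 2⦌, SSet.Fills y c :=
    have := SSet.hasDimensionLE_of_isSkeletal hX
    hc.existsUnique_fills hn (by lia)
  have hcosk (n : ℕ) (hn : 2 ≤ n) (X : SSet.{u}) (hX : (SSet.level.{u} n).IsSkeletal X) :
      (SSet.level.{u} (2 * n - 1)).IsCoskeletal X :=
    SSet.isCoskeletal_of_existsUnique_fills (by lia) (hfill n hn X hX)
  refine ⟨fun n hn => ⟨⟨SSet.level_isLowerThan_level (by lia), hcosk n hn⟩, fun N hN => ?_⟩,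
    fun n hn X hX => ⟨hcosk n hn X hX, hfill n hn X hX⟩, fun n p hn hp => ?_⟩
  · obtain ⟨p, rfl⟩ : ∃ p, n = p + 2 := ⟨n - 2, by lia⟩
    obtain h | h := SSet.isSkeletal_stdSimplex_or_isIso N (2 * p + 3)
    · exact SSet.level_isLowerThan_of_isSkeletal_stdSimplex h
    · -- then the `(2 * n - 1)`-spheres of every `n`-skeletal object would have fillers
      exact absurd (SSet.hornWedge.isSphere_pairSphere.exists_fills
        (hN.2 (SSet.hornWedge p) SSet.isSkeletal_of_hasDimensionLE))
        SSet.hornWedge.not_exists_fills_pairSphere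
  · subst hp
    refine ⟨SSet.hornWedge p, _, _, _, _, _, SSet.hornWedge.isGeneratedByPair,
      SSet.isSkeletal_of_hasDimensionLE, SSet.hornWedge.isSphere_pairSphere,
      SSet.hornWedge.not_exists_fills_pairSphere, fun h => ?_⟩
    have := SSet.isIso_level_restr_map_boundary_ι.{u} (n := 2 * (p + 2) - 2) (k := 2 * p + 3)
      (by lia)
    exact SSet.hornWedge.not_exists_fills_pairSphere
      (SSet.hornWedge.isSphere_pairSphere.exists_fills h)
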